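/- Let $n$ be a positive integer and let $\mathcal{C}$ be an additive and idempotent complete category. For $m\ge 1$: - A sequence $X_m\xrightarrow{f_m}\cdots\xrightarrow{f_2}X_1\xrightarrow{f_1}X_0$ in $\mathcal{C}$ is an *$m$-kernel* of a morphism $f\colon X_0\to Y$ if $0\to\mathcal{C}(-,X_m)\to\cdots\to\mathcal{C}(-,X_1)\to\mathcal{C}(-,X_0)\xrightarrow{\mathcal{C}(-,f)}\mathcal{C}(-,Y)$ is exact (that is, exact as a sequence of abelian groups at every object of $\mathcal{C}$). Dually, a sequence $Y_0\xrightarrow{g_1}Y_1\xrightarrow{g_2}\cdots\xrightarrow{g_m}Y_m$ is an *$m$-cokernel* of $f\colon X\to Y_0$ if $0\to\mathcal{C}(Y_m,-)\to\cdots\to\mathcal{C}(Y_1,-)\to\mathcal{C}(Y_0,-)\xrightarrow{\mathcal{C}(f,-)}\mathcal{C}(X,-)$ is exact. A sequence is called an $m$-kernel (respectively, $m$-cokernel) in $\mathcal{C}$ if it is an $m$-kernel (respectively, $m$-cokernel) of some morphism of $\mathcal{C}$. The category $\mathcal{C}$ *has $n$-kernels* (respectively, *has $n$-cokernels*) if every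 morphism of $\mathcal{C}$ has an $n$-kernel (respectively, an $n$-cokernel). - A sequence $X_m\xrightarrow{f_m}\cdots\xrightarrow{f_1}X_0$ is an *$m$-segment* if both $0\to\mathcal{C}(-,X_m)\to\cdots\to\mathcal{C}(-,X_0)$ and $\mathcal{C}(X_0,-)\to\mathcal{C}(X_1,-)\to\cdots\to\mathcal{C}(X_m,-)$ are exact. Dually, a sequence $Y_0\xrightarrow{g_1}\cdots\xrightarrow{g_m}Y_m$ is an *$m$-cosegment* if both $0\to\mathcal{C}(Y_m,-)\to\cdots\to\mathcal{C}(Y_0,-)$ and $\mathcal{C}(-,Y_0)\to\mathcal{C}(-,Y_1)\to\cdots\to\mathcal{C}(-,Y_m)$ are exact. - $\mathcal{C}$ is *$n$-abelian* if (A1) it has $n$-kernels; (A1$^{\mathrm{op}}$) it has $n$-cokernels; (A2) for every monomorphism $f\colon X\to Y$ and every $n$-cokernel $Y\xrightarrow{g_1}Y_1\to\cdots\xrightarrow{g_n}Y_n$ of $f$, the sequence $X\xrightarrow{f}Y\xrightarrow{g_1}\cdots\xrightarrow{g_{n-1}}Y_{n-1}$ is an $n$-kernel of $g_n$; and (A2$^{\mathrm{op}}$)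 for every epimorphism $f\colon X\to Y$ and every $n$-kernel $X_n\xrightarrow{f_n}\cdots\to X_1\xrightarrow{f_1}X$ of $f$, the sequence $X_{n-1}\xrightarrow{f_{n-1}}\cdots\xrightarrow{f_1}X\xrightarrow{f}Y$ is an $n$-cokernel of $f_n$. **Theorem.** The category $\mathcal{C}$ is $n$-abelian if and only if all of the following hold: $\mathcal{C}$ has $n$-kernels; $\mathcal{C}$ has $n$-cokernels; every $m$-segment in $\mathcal{C}$ is an $m$-kernel in $\mathcal{C}$, for all $1\le m\le n$; and every $m$-cosegment in $\mathcal{C}$ is an $m$-cokernel in $\mathcal{C}$, for all $1\le m\le n$. -/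

import Mathlib

open CategoryTheory CategoryTheory.Limits

universe v u

namespace HigherHomological

section

variable {C : Type u} [Category.{v} C] [Preadditive C]

/-- For a sequence `S₀ ⟶ S₁ ⟶ ⋯ ⟶ Sₘ`, the sequence of right modules
`C(-, S₀) ⟶ C(-, S₁) ⟶ ⋯ ⟶ C(-, Sₘ)` is exact, i.e. for every object `W` the sequence of
abelian groups `C(W, S₀) ⟶ ⋯ ⟶ C(W, Sₘ)` is exact at `C(W, S₁), …, C(W, Sₘ₋₁)`. -/
def ContravariantExact {m : ℕ} (S : ComposableArrows C m) : Prop :=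
  ∀ (i : ℕ) (_ : i + 2 ≤ m) (W : C),
    Function.Exact
      (fun x : W ⟶ S.obj' i => x ≫ S.map' i (i + 1))
      (fun x : W ⟶ S.obj' (i + 1) => x ≫ S.map' (i + 1) (i + 2))

/-- For a sequence `S₀ ⟶ S₁ ⟶ ⋯ ⟶ Sₘ`, the sequence of left modules
`C(Sₘ, -) ⟶ ⋯ ⟶ C(S₁, -) ⟶ C(S₀, -)` is exact (no condition at the two ends). -/
def CovariantExact {m : ℕ} (S : ComposableArrows C m) : Prop :=
  ∀ (i : ℕ) (_ : i + 2 ≤ m) (W : C),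
    Function.Exact
      (fun x : S.obj' (i + 2) ⟶ W => S.map' (i + 1) (i + 2) ≫ x)
      (fun x : S.obj' (i + 1) ⟶ W => S.map' i (i + 1) ≫ x)

/-- `0 ⟶ C(-, S₀) ⟶ C(-, S₁) ⟶ ⋯ ⟶ C(-, Sₘ)` is exact (for `m ≥ 1`). -/
def ContravariantLeftExact {m : ℕ} (S : ComposableArrows C m) : Prop :=
  (∀ (_ : 1 ≤ m) (W : C), Function.Injective (fun x : W ⟶ S.obj' 0 => x ≫ S.map' 0 1)) ∧
    ContravariantExact S

/-- `0 ⟶ C(Sₘ, -) ⟶ ⋯ ⟶ C(S₁, -) ⟶ C(S₀, -)` is exact (for `m ≥ 1`). -/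
def CovariantLeftExact {m : ℕ} (S : ComposableArrows C m) : Prop :=
  (∀ (i : ℕ) (_ : i + 1 = m) (W : C),
      Function.Injective (fun x : S.obj' (i + 1) ⟶ W => S.map' i (i + 1) ≫ x)) ∧
    CovariantExact S

/-- The sequence `S₀ ⟶ ⋯ ⟶ Sₘ` (with `m` morphisms, `m ≥ 1`) is an `m`-kernel of
`f : Sₘ ⟶ Y`: the sequence `0 ⟶ C(-, S₀) ⟶ ⋯ ⟶ C(-, Sₘ) ⟶ C(-, Y)` is exact. -/
def IsKernelSeq {m : ℕ} (S : ComposableArrows C m) {Y : C} (f : S.right ⟶ Y) : Prop :=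
  ContravariantLeftExact S ∧
    ∀ (i : ℕ) (_ : i + 1 = m) (W : C),
      Function.Exact
        (fun x : W ⟶ S.obj' i => (x ≫ S.map' i m : W ⟶ S.right))
        (fun x : W ⟶ S.right => x ≫ f)

/-- The sequence `S₀ ⟶ ⋯ ⟶ Sₘ` (with `m` morphisms, `m ≥ 1`) is an `m`-cokernel of
`f : X ⟶ S₀`: the sequence `0 ⟶ C(Sₘ, -) ⟶ ⋯ ⟶ C(S₀, -) ⟶ C(X, -)` is exact. -/
def IsCokernelSeq {m : ℕ} {X : C} (S : ComposableArrows C m) (f : X ⟶ S.left) : Prop :=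
  CovariantLeftExact S ∧
    ∀ (_ : 1 ≤ m) (W : C),
      Function.Exact
        (fun x : S.obj' 1 ⟶ W => (S.map' 0 1 ≫ x : S.left ⟶ W))
        (fun x : S.left ⟶ W => f ≫ x)

/-- `m`-segments (`m ≥ 1`), written `S₀ ⟶ ⋯ ⟶ Sₘ`. -/
def IsSegment {m : ℕ} (S : ComposableArrows C m) : Prop :=
  ContravariantLeftExact S ∧ CovariantExact S

/-- `m`-cosegments (`m ≥ 1`), written `S₀ ⟶ ⋯ ⟶ Sₘ`. -/
def IsCosegment {m : ℕ} (S : ComposableArrows C m) : Prop :=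
  CovariantLeftExact S ∧ ContravariantExact S

end

section

variable (C : Type u) [Category.{v} C] [Preadditive C]

/-- Every morphism has an `n`-kernel. -/
def HasNKernels (n : ℕ) : Prop :=
  ∀ ⦃X Y : C⦄ (f : X ⟶ Y),
    ∃ (S : ComposableArrows C n) (h : S.right = X), IsKernelSeq S (eqToHom h ≫ f)

/-- Every morphism has an `n`-cokernel. -/
def HasNCokernels (n : ℕ) : Prop :=
  ∀ ⦃X Y : C⦄ (f : X ⟶ Y),
    ∃ (S : ComposableArrows C n) (h : Y = S.left), IsCokernelSeq S (f ≫ eqToHom h)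

/-- `n`-abelian categories (`n ≥ 1`), among additive idempotent complete categories.
In the last two axioms a morphism together with an `n`-cokernel (or `n`-kernel) of it is
given as one sequence `T₀ ⟶ T₁ ⟶ ⋯ ⟶ Tₙ₊₁`; `T.δ₀` and `T.δlast` are the sequences
`T₁ ⟶ ⋯ ⟶ Tₙ₊₁` and `T₀ ⟶ ⋯ ⟶ Tₙ`. -/
structure IsNAbelian [HasFiniteBiproducts C] [IsIdempotentComplete C] (n : ℕ) : Prop where
  hasNKernels : HasNKernels C n
  hasNCokernels : HasNCokernels C n
  isKernelSeq_of_mono : ∀ T : ComposableArrows C (n + 1), Mono (T.map' 0 1) →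
    IsCokernelSeq T.δ₀ (T.map' 0 1) → IsKernelSeq T.δlast (T.map' n (n + 1))
  isCokernelSeq_of_epi : ∀ T : ComposableArrows C (n + 1), Epi (T.map' n (n + 1)) →
    IsKernelSeq T.δlast (T.map' n (n + 1)) → IsCokernelSeq T.δ₀ (T.map' 0 1)

end

end HigherHomological

/-!
The heart of the matter is the behaviour of a single morphism `d` of a sequence. Two covariantly
exact sequences which start with the same morphism are homotopy equivalent, so corresponding
morphisms `d`, `d'` in them are related by squares `i : d ⟶ d'` and `r : d' ⟶ d` with
`d ≫ i ≫ r = d + d ≫ h ≫ d` for some homotopy `h`. If such a `d'` is a weak kernel of `g'`, then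
`d` is a weak kernel of the morphism with components `i ≫ g'` and `i ≫ r - 𝟙 - h ≫ d`. For an
`n`-abelian category, apply this to an `m`-segment and to the sequence formed by its first morphism
and an `n`-cokernel of it: the latter is contravariantly exact by (A2), so that all of its morphisms
but the last are weak kernels.

Conversely, let `T` be a monomorphism followed by an `n`-cokernel of it. If `T` is contravariantly
exact up to a given degree, then the part of `T` up to that degree is a segment, hence a kernel of
some `p`, and `p` factors through the next morphism of `T`; so `T` is contravariantly exact one
degree further. The remaining halves are dual.
-/

namespace HigherHomological

section ComposableArrows

variable {C : Type u} [Category.{v} C] {n : ℕ}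

/-- The first `k` morphisms of a sequence. -/
abbrev initialSegment (T : ComposableArrows C n) {k : ℕ} (hk : k ≤ n) : ComposableArrows C k :=
  T.whiskerLeft (Fin.castLEOrderEmb (Nat.succ_le_succ hk)).monotone.functor

/-- A sequence regarded as its last morphism and the sequence of all the others. -/
def splitLast (T : ComposableArrows C (n + 1)) :
    Σ (K : ComposableArrows C n) (Y : C), (K.right ⟶ Y) :=
  ⟨T.δlast, T.obj' (n + 1), T.map' n (n + 1)⟩

lemma splitLast_surjective : Function.Surjective (splitLast (C := C) (n := n)) := by
  rintro ⟨K, Y, g⟩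
  induction n with
  | zero =>
    obtain ⟨X, rfl⟩ := K.mk₀_surjective
    exact ⟨.mk₁ g, Sigma.ext (ComposableArrows.ext₀ rfl) HEq.rfl⟩
  | succ n ih =>
    obtain ⟨K, X, f, rfl⟩ := K.precomp_surjective
    obtain ⟨T, hT⟩ := ih K g
    cases hT
    exact ⟨T.precomp f, Sigma.ext (ComposableArrows.ext_succ rfl rfl
      ((Category.comp_id f).symm.trans (Category.id_comp _).symm)) HEq.rfl⟩

end ComposableArrows

section WeakKernel

variable {C : Type u} [Category.{v} C] [Preadditive C] {X Y Z : C} {f : X ⟶ Y} {g : Y ⟶ Z}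

/-- `f` is a weak kernel of `g`: the sequence `C(-, X) ⟶ C(-, Y) ⟶ C(-, Z)` is exact. The exactness
conditions in `ContravariantExact` and `IsKernelSeq` are of this form. -/
def IsWeakKernel (f : X ⟶ Y) (g : Y ⟶ Z) : Prop :=
  ∀ W : C, Function.Exact (fun x : W ⟶ X => x ≫ f) (fun x : W ⟶ Y => x ≫ g)

/-- `g` is a weak cokernel of `f`: the sequence `C(Z, -) ⟶ C(Y, -) ⟶ C(X, -)` is exact. The
exactness conditions in `CovariantExact` and `IsCokernelSeq` are of this form. -/
def IsWeakCokernel (f : X ⟶ Y) (g : Y ⟶ Z) : Prop :=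
  ∀ W : C, Function.Exact (fun x : Z ⟶ W => g ≫ x) (fun x : Y ⟶ W => f ≫ x)

lemma isWeakKernel_iff :
    IsWeakKernel f g ↔ f ≫ g = 0 ∧ ∀ ⦃W : C⦄ (x : W ⟶ Y), x ≫ g = 0 → ∃ y, y ≫ f = x := by
  refine ⟨fun h => ⟨(h X f).2 ⟨𝟙 X, Category.id_comp f⟩, fun W x hx => (h W x).1 hx⟩, ?_⟩
  rintro ⟨w, lift⟩ W x
  refine ⟨lift x, ?_⟩
  rintro ⟨y, rfl⟩
  simp only [Category.assoc, w, comp_zero]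

lemma isWeakCokernel_iff :
    IsWeakCokernel f g ↔ f ≫ g = 0 ∧ ∀ ⦃W : C⦄ (x : Y ⟶ W), f ≫ x = 0 → ∃ y, g ≫ y = x := by
  refine ⟨fun h => ⟨(h Z g).2 ⟨𝟙 Z, Category.comp_id g⟩, fun W x hx => (h W x).1 hx⟩, ?_⟩
  rintro ⟨w, desc⟩ W x
  refine ⟨desc x, ?_⟩
  rintro ⟨y, rfl⟩
  simp only [reassoc_of% w, zero_comp]

lemma IsWeakKernel.op (h : IsWeakKernel f g) : IsWeakCokernel g.op f.op := by
  obtain ⟨w, lift⟩ := isWeakKernel_iff.1 h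
  refine isWeakCokernel_iff.2 ⟨Quiver.Hom.unop_inj w, fun W x hx => ?_⟩
  obtain ⟨y, hy⟩ := lift x.unop (Quiver.Hom.op_inj hx)
  exact ⟨y.op, Quiver.Hom.unop_inj hy⟩

lemma isWeakKernel_op_iff : IsWeakKernel g.op f.op ↔ IsWeakCokernel f g := by
  rw [isWeakKernel_iff, isWeakCokernel_iff]
  refine and_congr Quiver.Hom.op_inj.eq_iff ⟨fun lift W x hx => ?_, fun desc W x hx => ?_⟩
  · obtain ⟨y, hy⟩ := lift x.op (Quiver.Hom.unop_inj hx)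
    exact ⟨y.unop, Quiver.Hom.op_inj hy⟩
  · obtain ⟨y, hy⟩ := desc x.unop (Quiver.Hom.op_inj hx)
    exact ⟨y.op, Quiver.Hom.unop_inj hy⟩

lemma IsWeakKernel.of_isWeakCokernel {P : C} {p : Y ⟶ P} (hp : IsWeakKernel f p)
    (hg : IsWeakCokernel f g) : IsWeakKernel f g := by
  rw [isWeakKernel_iff] at hp ⊢
  rw [isWeakCokernel_iff] at hg
  obtain ⟨q, rfl⟩ := hg.2 p hp.1
  exact ⟨hg.1, fun W x hx => hp.2 x (by rw [reassoc_of% hx, zero_comp])⟩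

lemma IsWeakCokernel.of_isWeakKernel {P : C} {p : P ⟶ Y} (hp : IsWeakCokernel p g)
    (hf : IsWeakKernel f g) : IsWeakCokernel f g :=
  isWeakKernel_op_iff.1 ((isWeakKernel_op_iff.2 hp).of_isWeakCokernel hf.op)

lemma isWeakKernel_biprod_lift [HasBinaryBiproducts C] {Z₁ Z₂ : C} {g₁ : Y ⟶ Z₁}
    {g₂ : Y ⟶ Z₂} (w₁ : f ≫ g₁ = 0) (w₂ : f ≫ g₂ = 0)
    (lift : ∀ ⦃W : C⦄ (x : W ⟶ Y), x ≫ g₁ = 0 → x ≫ g₂ = 0 → ∃ y, y ≫ f = x) :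
    IsWeakKernel f (biprod.lift g₁ g₂) := by
  refine isWeakKernel_iff.2 ⟨by ext <;> simp [w₁, w₂], fun W x hx => lift x ?_ ?_⟩
  · simpa using hx =≫ biprod.fst
  · simpa using hx =≫ biprod.snd

end WeakKernel

section HomotopyRetract

variable {C : Type u} [Category.{v} C] [Preadditive C]

/-- `d` is a retract of `d'` up to homotopy, in the sense needed to compare two exact sequences in
which `d` and `d'` are corresponding morphisms. The last equation is the self-dual form both of
`d ≫ (i₁ ≫ r₁ - 𝟙 A₁ - h ≫ d) = 0` and of `(i₀ ≫ r₀ - 𝟙 A₀ - d ≫ h) ≫ d = 0`. -/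
def IsHomotopyRetract {A₀ A₁ B₀ B₁ : C} (d : A₀ ⟶ A₁) (d' : B₀ ⟶ B₁) : Prop :=
  ∃ (i₀ : A₀ ⟶ B₀) (i₁ : A₁ ⟶ B₁) (r₀ : B₀ ⟶ A₀) (r₁ : B₁ ⟶ A₁) (h : A₁ ⟶ A₀),
    d ≫ i₁ = i₀ ≫ d' ∧ d' ≫ r₁ = r₀ ≫ d ∧ d ≫ i₁ ≫ r₁ = d + d ≫ h ≫ d

namespace IsHomotopyRetract

variable {A₀ A₁ A₂ B₀ B₁ B₂ : C} {d : A₀ ⟶ A₁} {d' : B₀ ⟶ B₁} {e : A₁ ⟶ A₂} {e' : B₁ ⟶ B₂}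

lemma of_arrow_iso (φ : Arrow.mk d ≅ Arrow.mk d') : IsHomotopyRetract d d' :=
  ⟨φ.hom.left, φ.hom.right, φ.inv.left, φ.inv.right, 0, (Arrow.w_mk_right φ.hom).symm,
    (Arrow.w_mk_right φ.inv).symm, by simp [← Arrow.comp_right]⟩

lemma op (H : IsHomotopyRetract d d') : IsHomotopyRetract d.op d'.op := by
  obtain ⟨i₀, i₁, r₀, r₁, h, hi, hr, hh⟩ := H
  refine ⟨r₁.op, r₀.op, i₁.op, i₀.op, h.op, congrArg Quiver.Hom.op hr.symm,
    congrArg Quiver.Hom.op hi.symm, ?_⟩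
  rw [reassoc_of% hi, hr] at hh
  simpa using congrArg Quiver.Hom.op hh

lemma unop (H : IsHomotopyRetract d.op d'.op) : IsHomotopyRetract d d' := by
  obtain ⟨i₀, i₁, r₀, r₁, h, hi, hr, hh⟩ := H
  refine ⟨r₁.unop, r₀.unop, i₁.unop, i₀.unop, h.unop, congrArg Quiver.Hom.unop hr.symm,
    congrArg Quiver.Hom.unop hi.symm, ?_⟩
  rw [reassoc_of% hi, hr] at hh
  simpa using congrArg Quiver.Hom.unop hh

lemma of_isWeakCokernel (H : IsHomotopyRetract d d') (he : IsWeakCokernel d e)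
    (he' : IsWeakCokernel d' e') : IsHomotopyRetract e e' := by
  obtain ⟨i₀, i₁, r₀, r₁, h, hi, hr, hh⟩ := H
  obtain ⟨w, desc⟩ := isWeakCokernel_iff.1 he
  obtain ⟨w', desc'⟩ := isWeakCokernel_iff.1 he'
  obtain ⟨i₂, hi₂⟩ := desc (i₁ ≫ e') (by rw [reassoc_of% hi, w', comp_zero])
  obtain ⟨r₂, hr₂⟩ := desc' (r₁ ≫ e) (by rw [reassoc_of% hr, w, comp_zero])
  obtain ⟨k, hk⟩ := desc (i₁ ≫ r₁ - 𝟙 A₁ - h ≫ d) (by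
    simp only [Preadditive.comp_sub, hh, Category.comp_id]
    abel)
  refine ⟨i₁, i₂, r₁, r₂, k, hi₂, hr₂, ?_⟩
  calc e ≫ i₂ ≫ r₂ = i₁ ≫ r₁ ≫ e := by rw [reassoc_of% hi₂, hr₂]
    _ = e + (i₁ ≫ r₁ - 𝟙 A₁ - h ≫ d) ≫ e := by simp [w]
    _ = e + e ≫ k ≫ e := by rw [← hk, Category.assoc]

lemma of_isWeakKernel (H : IsHomotopyRetract e e') (hd : IsWeakKernel d e)
    (hd' : IsWeakKernel d' e') : IsHomotopyRetract d d' :=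
  (H.op.of_isWeakCokernel hd.op hd'.op).unop

lemma exists_isWeakKernel [HasBinaryBiproducts C] (H : IsHomotopyRetract d d')
    (hd' : IsWeakKernel d' e') : ∃ (Z : C) (g : A₁ ⟶ Z), IsWeakKernel d g := by
  obtain ⟨i₀, i₁, r₀, r₁, h, hi, hr, hh⟩ := H
  obtain ⟨w', lift'⟩ := isWeakKernel_iff.1 hd'
  refine ⟨_, _, isWeakKernel_biprod_lift (g₁ := i₁ ≫ e') (g₂ := i₁ ≫ r₁ - 𝟙 A₁ - h ≫ d)
    ?_ ?_ fun W x hx₁ hx₂ => ?_⟩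
  · rw [reassoc_of% hi, w', comp_zero]
  · simp only [Preadditive.comp_sub, hh, Category.comp_id]
    abel
  · obtain ⟨z, hz⟩ := lift' (x ≫ i₁) (by rw [Category.assoc, hx₁])
    have hx : x ≫ i₁ ≫ r₁ - x - x ≫ h ≫ d = 0 := by simpa using hx₂
    refine ⟨z ≫ r₀ - x ≫ h, ?_⟩
    calc (z ≫ r₀ - x ≫ h) ≫ d = x ≫ i₁ ≫ r₁ - x ≫ h ≫ d := by
          simp [← hr, reassoc_of% hz]
      _ = x := by rw [← sub_eq_zero, ← hx]; abel

lemma exists_isWeakCokernel [HasBinaryBiproducts C] (H : IsHomotopyRetract e e')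
    (he' : IsWeakCokernel d' e') : ∃ (Z : C) (g : Z ⟶ A₁), IsWeakCokernel g e := by
  obtain ⟨Z, g, hg⟩ := H.op.exists_isWeakKernel (isWeakKernel_op_iff.2 he')
  exact ⟨Z.unop, g.unop, isWeakKernel_op_iff.1 hg⟩

end IsHomotopyRetract

end HomotopyRetract

section Sequences

variable {C : Type u} [Category.{v} C] [Preadditive C] {m n : ℕ}

lemma contravariantLeftExact_iff {S : ComposableArrows C (m + 1)} :
    ContravariantLeftExact S ↔ Mono (S.map' 0 1) ∧ ContravariantExact S := by
  simp [ContravariantLeftExact, mono_iff_forall_injective]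

lemma covariantLeftExact_iff {S : ComposableArrows C (m + 1)} :
    CovariantLeftExact S ↔ Epi (S.map' m (m + 1)) ∧ CovariantExact S := by
  refine and_congr_left fun _ => ?_
  rw [epi_iff_forall_injective]
  refine ⟨fun h => h m rfl, ?_⟩
  rintro h i hi
  obtain rfl : i = m := by lia
  exact h

lemma isKernelSeq_iff {S : ComposableArrows C (m + 1)} {Y : C} {f : S.right ⟶ Y} :
    IsKernelSeq S f ↔ ContravariantLeftExact S ∧
      IsWeakKernel (Y := S.right) (S.map' m (m + 1)) f := by
  refine and_congr_right fun _ => ⟨fun h => h m rfl, ?_⟩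
  rintro h i hi
  obtain rfl : i = m := by lia
  exact h

lemma isCokernelSeq_iff {S : ComposableArrows C (m + 1)} {X : C} {f : X ⟶ S.left} :
    IsCokernelSeq S f ↔ CovariantLeftExact S ∧ IsWeakCokernel (Y := S.left) f (S.map' 0 1) :=
  and_congr_right fun _ => ⟨fun h => h (by lia), fun h _ => h⟩

lemma isKernelSeq_δlast_iff (hn : 1 ≤ n) (T : ComposableArrows C (n + 1)) :
    IsKernelSeq T.δlast (T.map' n (n + 1)) ↔ ContravariantLeftExact T := by
  obtain ⟨n, rfl⟩ := Nat.exists_eq_add_of_le' hn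
  refine (isKernelSeq_iff (S := T.δlast)).trans ?_
  rw [contravariantLeftExact_iff, contravariantLeftExact_iff, and_assoc]
  refine and_congr_right fun _ => ⟨fun ⟨h, h_last⟩ i hi => ?_,
    fun h => ⟨fun i hi => h i (by lia), h n le_rfl⟩⟩
  obtain hi' | rfl : i + 2 ≤ n + 1 ∨ i = n := by lia
  · exact h i hi'
  · exact h_last

lemma isCokernelSeq_δ₀_iff (hn : 1 ≤ n) (T : ComposableArrows C (n + 1)) :
    IsCokernelSeq T.δ₀ (T.map' 0 1) ↔ CovariantLeftExact T := by
  obtain ⟨n, rfl⟩ := Nat.exists_eq_add_of_le' hn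
  refine (isCokernelSeq_iff (S := T.δ₀)).trans ?_
  rw [covariantLeftExact_iff, covariantLeftExact_iff, and_assoc]
  refine and_congr_right fun _ => ⟨fun ⟨h, h_first⟩ i hi => ?_,
    fun h => ⟨fun i hi => h (i + 1) (by lia), h 0 (by lia)⟩⟩
  obtain _ | i := i
  · exact h_first
  · exact h i (by lia)

lemma CovariantExact.isHomotopyRetract {S : ComposableArrows C (m + 1)}
    {T : ComposableArrows C (n + 1)} (hS : CovariantExact S) (hT : CovariantExact T)
    (H : IsHomotopyRetract (S.map' 0 1) (T.map' 0 1)) (j : ℕ) (hjm : j ≤ m) (hjn : j ≤ n) :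
    IsHomotopyRetract (S.map' j (j + 1)) (T.map' j (j + 1)) := by
  induction j with
  | zero => exact H
  | succ j ih =>
    exact (ih (by lia) (by lia)).of_isWeakCokernel (hS j (by lia)) (hT j (by lia))

lemma ContravariantExact.isHomotopyRetract {S : ComposableArrows C (m + 1)}
    {T : ComposableArrows C (n + 1)} (hS : ContravariantExact S) (hT : ContravariantExact T)
    (H : IsHomotopyRetract (S.map' m (m + 1)) (T.map' n (n + 1))) (j a b : ℕ) (ha : a + j = m)
    (hb : b + j = n) : IsHomotopyRetract (S.map' a (a + 1)) (T.map' b (b + 1)) := by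
  induction j generalizing a b with
  | zero =>
    obtain rfl : a = m := ha
    obtain rfl : b = n := hb
    exact H
  | succ j ih =>
    exact (ih (a + 1) (b + 1) (by lia) (by lia)).of_isWeakKernel (hS a (by lia)) (hT b (by lia))

lemma HasNKernels.exists_arrow_iso (hC : HasNKernels C n) {X Y : C} (f : X ⟶ Y) :
    ∃ T : ComposableArrows C (n + 1), Nonempty (Arrow.mk f ≅ Arrow.mk (T.map' n (n + 1))) ∧
      IsKernelSeq T.δlast (T.map' n (n + 1)) := by
  obtain ⟨K, rfl, hK⟩ := hC f
  rw [eqToHom_refl, Category.id_comp] at hK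
  obtain ⟨T, hT⟩ := splitLast_surjective ⟨K, Y, f⟩
  cases hT
  exact ⟨T, ⟨Iso.refl _⟩, hK⟩

lemma HasNCokernels.exists_arrow_iso (hC : HasNCokernels C n) {X Y : C} (f : X ⟶ Y) :
    ∃ T : ComposableArrows C (n + 1), Nonempty (Arrow.mk f ≅ Arrow.mk (T.map' 0 1)) ∧
      IsCokernelSeq T.δ₀ (T.map' 0 1) := by
  obtain ⟨K, rfl, hK⟩ := hC f
  rw [eqToHom_refl, Category.comp_id] at hK
  exact ⟨K.precomp f, ⟨Iso.refl _⟩, hK⟩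

end Sequences

section NAbelian

variable (C : Type u) [Category.{v} C] [Preadditive C]

/-- Axiom (A2) of an `n`-abelian category: a monomorphism and the morphisms of an `n`-cokernel of
it, except for the last one, form an `n`-kernel of the last one. -/
def MonosAreKernels (n : ℕ) : Prop :=
  ∀ T : ComposableArrows C (n + 1), Mono (T.map' 0 1) →
    IsCokernelSeq T.δ₀ (T.map' 0 1) → IsKernelSeq T.δlast (T.map' n (n + 1))

/-- Axiom (A2ᵒᵖ) of an `n`-abelian category: the morphisms of an `n`-kernel of an epimorphism,
except for the first one, and the epimorphism form an `n`-cokernel of the first one. -/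
def EpisAreCokernels (n : ℕ) : Prop :=
  ∀ T : ComposableArrows C (n + 1), Epi (T.map' n (n + 1)) →
    IsKernelSeq T.δlast (T.map' n (n + 1)) → IsCokernelSeq T.δ₀ (T.map' 0 1)

/-- For `1 ≤ m ≤ n`, every `m`-segment is an `m`-kernel of some morphism. -/
def SegmentsAreKernels (n : ℕ) : Prop :=
  ∀ m : ℕ, 1 ≤ m → m ≤ n → ∀ S : ComposableArrows C m, IsSegment S →
    ∃ (Y : C) (f : S.right ⟶ Y), IsKernelSeq S f

/-- For `1 ≤ m ≤ n`, every `m`-cosegment is an `m`-cokernel of some morphism. -/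
def CosegmentsAreCokernels (n : ℕ) : Prop :=
  ∀ m : ℕ, 1 ≤ m → m ≤ n → ∀ S : ComposableArrows C m, IsCosegment S →
    ∃ (X : C) (f : X ⟶ S.left), IsCokernelSeq S f

variable {C} {n : ℕ}

lemma MonosAreKernels.segmentsAreKernels [HasBinaryBiproducts C] (hM : MonosAreKernels C n)
    (hC : HasNCokernels C n) : SegmentsAreKernels C n := by
  intro m hm hmn S hS
  obtain ⟨m, rfl⟩ := Nat.exists_eq_add_of_le' hm
  obtain ⟨T, ⟨φ⟩, hT⟩ := hC.exists_arrow_iso (S.map' 0 1)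
  have hT₀ : Mono (T.map' 0 1) :=
    ((MorphismProperty.monomorphisms C).arrow_mk_iso_iff φ).1 (contravariantLeftExact_iff.1 hS.1).1
  have hT_contra : ContravariantExact T :=
    ((isKernelSeq_δlast_iff (by lia) T).1 (hM T hT₀ hT)).2
  have hT_co : CovariantExact T := ((isCokernelSeq_δ₀_iff (by lia) T).1 hT).2
  have H : IsHomotopyRetract (S.map' m (m + 1)) (T.map' m (m + 1)) :=
    hS.2.isHomotopyRetract hT_co (.of_arrow_iso φ) m le_rfl (by lia)
  obtain ⟨Y, g, hg⟩ := H.exists_isWeakKernel (hT_contra m (by lia))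
  exact ⟨Y, g, isKernelSeq_iff.2 ⟨hS.1, hg⟩⟩

lemma EpisAreCokernels.cosegmentsAreCokernels [HasBinaryBiproducts C] (hE : EpisAreCokernels C n)
    (hC : HasNKernels C n) : CosegmentsAreCokernels C n := by
  intro m hm hmn S hS
  obtain ⟨m, rfl⟩ := Nat.exists_eq_add_of_le' hm
  obtain ⟨b, rfl⟩ : ∃ b, n = b + 1 + m := ⟨n - (m + 1), by lia⟩
  obtain ⟨T, ⟨φ⟩, hT⟩ := hC.exists_arrow_iso (S.map' m (m + 1))
  have hT_last : Epi (T.map' (b + 1 + m) (b + 1 + m + 1)) :=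
    ((MorphismProperty.epimorphisms C).arrow_mk_iso_iff φ).1 (covariantLeftExact_iff.1 hS.1).1
  have hT_co : CovariantExact T := ((isCokernelSeq_δ₀_iff (by lia) T).1 (hE T hT_last hT)).2
  have hT_contra : ContravariantExact T := ((isKernelSeq_δlast_iff (by lia) T).1 hT).2
  have H : IsHomotopyRetract (S.map' 0 1) (T.map' (b + 1) (b + 2)) :=
    hS.2.isHomotopyRetract hT_contra (.of_arrow_iso φ) m 0 (b + 1) (by lia) rfl
  obtain ⟨X, g, hg⟩ := H.exists_isWeakCokernel (hT_co b (by lia))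
  exact ⟨X, g, isCokernelSeq_iff.2 ⟨hS.1, hg⟩⟩

lemma SegmentsAreKernels.contravariantExact (hC : SegmentsAreKernels C n)
    {T : ComposableArrows C (n + 1)} (hT₀ : Mono (T.map' 0 1)) (hT : CovariantExact T) :
    ContravariantExact T := by
  intro i
  induction i using Nat.strong_induction_on with
  | _ i ih =>
    intro hi
    have h_segment : IsSegment (initialSegment T (k := i + 1) (by lia)) :=
      ⟨contravariantLeftExact_iff.2 ⟨hT₀, fun j hj => ih j (by lia) (by lia)⟩,
        fun j hj => hT j (by lia)⟩
    obtain ⟨Y, p, hp⟩ := hC (i + 1) (by lia) (by lia) _ h_segment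
    exact (isKernelSeq_iff.1 hp).2.of_isWeakCokernel (hT i hi)

lemma CosegmentsAreCokernels.covariantExact (hC : CosegmentsAreCokernels C n)
    {T : ComposableArrows C (n + 1)} (hT_last : Epi (T.map' n (n + 1)))
    (hT : ContravariantExact T) : CovariantExact T := by
  suffices ∀ k i (hi : i + 1 + (k + 1) = n + 1),
      IsWeakCokernel (T.map' i (i + 1)) (T.map' (i + 1) (i + 2)) from
    fun i hi => this (n - i - 1) i (by lia)
  intro k
  induction k using Nat.strong_induction_on with
  | _ k ih =>
    intro i hi
    obtain rfl : i + 1 + k = n := by lia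
    have h_cosegment : IsCosegment ((ComposableArrows.natAddLEFunctor hi.le).obj T) :=
      ⟨covariantLeftExact_iff.2 ⟨hT_last, fun j hj => ih (k - j - 1) (by lia) (i + 1 + j) (by lia)⟩,
        fun j hj => hT (i + 1 + j) (by lia)⟩
    obtain ⟨X, p, hp⟩ := hC (k + 1) (by lia) (by lia) _ h_cosegment
    exact (isCokernelSeq_iff.1 hp).2.of_isWeakKernel (hT i (by lia))

lemma monosAreKernels_iff_segmentsAreKernels [HasBinaryBiproducts C] (hn : 1 ≤ n)
    (hC : HasNCokernels C n) : MonosAreKernels C n ↔ SegmentsAreKernels C n := by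
  refine ⟨fun hM => hM.segmentsAreKernels hC, fun hS T hT₀ hT => ?_⟩
  rw [isCokernelSeq_δ₀_iff hn] at hT
  rw [isKernelSeq_δlast_iff hn, contravariantLeftExact_iff]
  exact ⟨hT₀, hS.contravariantExact hT₀ hT.2⟩

lemma episAreCokernels_iff_cosegmentsAreCokernels [HasBinaryBiproducts C] (hn : 1 ≤ n)
    (hC : HasNKernels C n) : EpisAreCokernels C n ↔ CosegmentsAreCokernels C n := by
  refine ⟨fun hE => hE.cosegmentsAreCokernels hC, fun hS T hT_last hT => ?_⟩
  rw [isKernelSeq_δlast_iff hn] at hT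
  rw [isCokernelSeq_δ₀_iff hn, covariantLeftExact_iff]
  exact ⟨hT_last, hS.covariantExact hT_last hT.2⟩

lemma isNAbelian_iff [HasFiniteBiproducts C] [IsIdempotentComplete C] :
    IsNAbelian C n ↔
      HasNKernels C n ∧ HasNCokernels C n ∧ MonosAreKernels C n ∧ EpisAreCokernels C n :=
  ⟨fun ⟨hK, hC, hM, hE⟩ => ⟨hK, hC, hM, hE⟩, fun ⟨hK, hC, hM, hE⟩ => ⟨hK, hC, hM, hE⟩⟩

end NAbelian

end HigherHomological

open HigherHomological in
theorem theorem8_general {C : Type u} [Category.{v} C] [Preadditive C] [HasBinaryBiproducts C]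
    (n : ℕ) (hn : 1 ≤ n) :
    HasNKernels C n ∧ HasNCokernels C n ∧ MonosAreKernels C n ∧ EpisAreCokernels C n ↔
      HasNKernels C n ∧ HasNCokernels C n ∧ SegmentsAreKernels C n ∧ CosegmentsAreCokernels C n :=
  and_congr_right fun hK => and_congr_right fun hC =>
    and_congr (monosAreKernels_iff_segmentsAreKernels hn hC)
      (episAreCokernels_iff_cosegmentsAreCokernels hn hK)

theorem theorem8 {C : Type u} [Category.{v} C] [Preadditive C] [HasFiniteBiproducts C]
    [IsIdempotentComplete C] (n : ℕ) (hn : 1 ≤ n) :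
    HigherHomological.IsNAbelian C n ↔
      HigherHomological.HasNKernels C n ∧
      HigherHomological.HasNCokernels C n ∧
      (∀ m : ℕ, 1 ≤ m → m ≤ n → ∀ S : ComposableArrows C m, HigherHomological.IsSegment S →
        ∃ (Y : C) (f : S.right ⟶ Y), HigherHomological.IsKernelSeq S f) ∧
      (∀ m : ℕ, 1 ≤ m → m ≤ n → ∀ S : ComposableArrows C m, HigherHomological.IsCosegment S →
        ∃ (X : C) (f : X ⟶ S.left), HigherHomological.IsCokernelSeq S f) := by
  have := hasBinaryBiproducts_of_finite_biproducts C
  exact HigherHomological.isNAbelian_iff.trans (theorem8_general n hn)
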